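/- Let $K$ be a number field with $r_1$ real embeddings and $r_2$ pairs of complex conjugate embeddings, $\mathcal O_K$ its ring of integers, $i\colon K\to\mathbb R^{r_1}\times\mathbb C^{r_2}$ the canonical embedding, and $N(x_1,\dots,x_{r_1},y_1,\dots,y_{r_2})=\prod_j|x_j|\prod_j|y_j|^2$. *Euclidean classes.* An ideal class $\mathcal C\in\mathrm{Cl}(K)$ is norm Euclidean if for a fractional ideal $I\in\mathcal C$ (equivalently, for every such $I$) and every $\beta\in K$ there is $\alpha\in I$ with $|N_{K/\mathbb Q}(\alpha-\beta)|<N_{K/\mathbb Q}(I)$. The inhomogeneous Euclidean minimum of $\mathcal C$ is $$\overline M_{\mathcal C}=\sup_{\mathbf x\in\mathbb R^{r_1}\times\mathbb C^{r_2}}\ \inf_{\gamma\in I}\ \frac{N(\mathbf x-i(\gamma))}{N_{K/\mathbb Q}(I)},$$ where $I$ is any fractional ideal in $\mathcal C$; it does not depend on the choice of $I$. *Continued fractions.* Let $\mathfrak P$ be a nonzero prime ideal of $\mathcal O_K$, $v_0$ the corresponding place and $K_{v_0}$ the completion. A $\mathfrak P$-adic floor function is a map $s\colon K_{v_0}\to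 K$ such that: $|\alpha-s(\alpha)|_{v_0}<1$ for all $\alpha\in K_{v_0}$; $|s(\alpha)|_v\le 1$ for all $\alpha\in K_{v_0}$ and all non-archimedean places $v\neq v_0$ of $K$; $s(0)=0$ and $s(s(\alpha))=s(\alpha)$ for all $\alpha\in K_{v_0}$; and $s(\alpha)=s(\beta)$ whenever $|\alpha-\beta|_{v_0}<1$. The expansion of $\alpha\in K_{v_0}$ with respect to $s$ is obtained by setting $\alpha_0=\alpha$, $a_n=s(\alpha_n)$ and $\alpha_{n+1}=1/(\alpha_n-a_n)$; it stops, and is called finite, if $\alpha_n=a_n$ for some $n$. The field $K$ has the $\mathfrak P$-adic CFF (continued fraction finiteness) property if there is a $\mathfrak P$-adic floor function with respect to which every element of $K$ has a finite expansion. **Theorem.** Suppose that $K$ has a norm Euclidean ideal class $\mathcal C$ with $\overline M_{\mathcal C}<1$. Then $K$ has the $\mathfrak P$-adic CFF property for all but finitely many prime ideals $\mathfrak P$ of $\mathcal O_K$ whose class in $\mathrm{Cl}(K)$ is $\mathcal C$. -/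

import Mathlib

open NumberField IsDedekindDomain
open scoped nonZeroDivisors ENNReal

noncomputable section

namespace PadicCF

variable (K : Type*) [Field K] [NumberField K]

/-! ### Continued fractions attached to a prime ideal

The finite places of `K` are the nonzero primes `P` of `𝓞 K`; `P.adicCompletion K` is the completion
at `P`. Only comparisons of absolute values with `1` occur, so they are expressed through the
(multiplicative) valuations. -/

/-- A `P`-adic floor function for `K`. -/
structure FloorFunction (P : HeightOneSpectrum (𝓞 K)) where
  /-- the underlying function `s : K_P → K` -/
  toFun : P.adicCompletion K → K
  sub_lt_one : ∀ α, Valued.v (α - algebraMap K (P.adicCompletion K) (toFun α)) < 1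
  integral_away : ∀ α, ∀ v : HeightOneSpectrum (𝓞 K), v ≠ P → v.valuation K (toFun α) ≤ 1
  map_zero : toFun 0 = 0
  idempotent : ∀ α, toFun (algebraMap K (P.adicCompletion K) (toFun α)) = toFun α
  locally_const : ∀ α β, Valued.v (α - β) < 1 → toFun α = toFun β

variable {K}

/-- The complete quotients of the expansion of `α`: `α₀ = α` and `αₙ₊₁ = 1 / (αₙ - aₙ)`, where
`aₙ = s(αₙ)` is the `n`-th partial quotient. The expansion stops at the first `n` with `αₙ = aₙ`;
the (conventional) values of this sequence after that index have no meaning. -/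
def FloorFunction.completeQuotient {P : HeightOneSpectrum (𝓞 K)} (s : FloorFunction K P)
    (α : P.adicCompletion K) : ℕ → P.adicCompletion K
  | 0 => α
  | n + 1 =>
    (s.completeQuotient α n -
      algebraMap K (P.adicCompletion K) (s.toFun (s.completeQuotient α n)))⁻¹

/-- The expansion of `α` is finite: the algorithm reaches an index `n` with `αₙ = aₙ`. (The first
such index is the index of the last partial quotient; before it, no division by zero occurs.) -/
def FloorFunction.HasFiniteExpansion {P : HeightOneSpectrum (𝓞 K)} (s : FloorFunction K P)
    (α : P.adicCompletion K) : Prop :=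
  ∃ n, s.completeQuotient α n =
    algebraMap K (P.adicCompletion K) (s.toFun (s.completeQuotient α n))

/-- The type `(K, P, s)` has the continued fraction finiteness property: every element of `K` has
a finite expansion. -/
def FloorFunction.CFF {P : HeightOneSpectrum (𝓞 K)} (s : FloorFunction K P) : Prop :=
  ∀ α : K, s.HasFiniteExpansion (algebraMap K (P.adicCompletion K) α)

variable (K)

/-- The field `K` has the `P`-adic continued fraction finiteness property. -/
def HasCFF (P : HeightOneSpectrum (𝓞 K)) : Prop :=
  ∃ s : FloorFunction K P, s.CFF

/-! ### Norm Euclidean ideal classes and inhomogeneous minima -/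

variable {K}

/-- The class `[P]` of a nonzero prime ideal. -/
def primeClass (P : HeightOneSpectrum (𝓞 K)) : ClassGroup (𝓞 K) :=
  ClassGroup.mk0 ⟨P.asIdeal, mem_nonZeroDivisors_of_ne_zero P.ne_bot⟩

/-- For every `β ∈ K` there is `α ∈ I` with `|N(α - β)| < N(I)`. -/
def IsNormEuclideanIdeal (I : (FractionalIdeal (𝓞 K)⁰ K)ˣ) : Prop :=
  ∀ β : K, ∃ α ∈ (I : FractionalIdeal (𝓞 K)⁰ K),
    |Algebra.norm ℚ (α - β)| < FractionalIdeal.absNorm (I : FractionalIdeal (𝓞 K)⁰ K)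

/-- A norm Euclidean class: one (equivalently, each) of its fractional ideals is norm Euclidean. -/
def IsNormEuclideanClass (C : ClassGroup (𝓞 K)) : Prop :=
  ∃ I : (FractionalIdeal (𝓞 K)⁰ K)ˣ, ClassGroup.mk K I = C ∧ IsNormEuclideanIdeal I

/-- The inhomogeneous minimum of a point `x ∈ ℝ^r₁ × ℂ^r₂` relative to `I`: the infimum over
`γ ∈ I` of `N(x - γ) / N(I)`. -/
def pointMinimum (I : (FractionalIdeal (𝓞 K)⁰ K)ˣ) (x : mixedEmbedding.mixedSpace K) : ℝ :=
  ⨅ γ : {γ : K // γ ∈ (I : FractionalIdeal (𝓞 K)⁰ K)},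
    mixedEmbedding.norm (x - mixedEmbedding K γ) /
      (FractionalIdeal.absNorm (I : FractionalIdeal (𝓞 K)⁰ K) : ℝ)

/-- The inhomogeneous Euclidean minimum of a fractional ideal: the supremum of the (nonnegative)
minima of all points of `ℝ^r₁ × ℂ^r₂`. -/
def idealMinimum (I : (FractionalIdeal (𝓞 K)⁰ K)ˣ) : ℝ≥0∞ :=
  ⨆ x : mixedEmbedding.mixedSpace K, ENNReal.ofReal (pointMinimum I x)

theorem exists_class_rep (C : ClassGroup (𝓞 K)) :
    ∃ I : (FractionalIdeal (𝓞 K)⁰ K)ˣ, ClassGroup.mk K I = C :=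
  ClassGroup.induction K (P := fun C => ∃ I, ClassGroup.mk K I = C) (fun I => ⟨I, rfl⟩) C

/-- The inhomogeneous Euclidean minimum of an ideal class, computed on a fractional ideal of the
class. It does not depend on this ideal, see `classMinimum_mk`. -/
def classMinimum (C : ClassGroup (𝓞 K)) : ℝ≥0∞ :=
  idealMinimum (exists_class_rep C).choose

theorem exists_mul_of_mk_eq {I J : (FractionalIdeal (𝓞 K)⁰ K)ˣ}
    (h : ClassGroup.mk K I = ClassGroup.mk K J) :
    ∃ c : Kˣ, I * toPrincipalIdeal (𝓞 K) K c = J := by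
  have h2 := congrArg (ClassGroup.equiv K) h
  rw [ClassGroup.equiv_mk, ClassGroup.equiv_mk, QuotientGroup.mk'_eq_mk'] at h2
  obtain ⟨z, ⟨c, rfl⟩, hz⟩ := h2
  refine ⟨c, ?_⟩
  have e : ∀ I : (FractionalIdeal (𝓞 K)⁰ K)ˣ, Units.mapEquiv
      (↑(FractionalIdeal.canonicalEquiv (𝓞 K)⁰ K K)) I = I := by
    intro I
    ext1
    simp [FractionalIdeal.canonicalEquiv_self]
  rw [e, e] at hz
  exact hz

theorem mem_mul_principal {I : (FractionalIdeal (𝓞 K)⁰ K)ˣ} {c : Kˣ} {x : K} :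
    x ∈ ((I * toPrincipalIdeal (𝓞 K) K c : (FractionalIdeal (𝓞 K)⁰ K)ˣ) :
      FractionalIdeal (𝓞 K)⁰ K) ↔ ∃ y ∈ (I : FractionalIdeal (𝓞 K)⁰ K), c * y = x := by
  rw [Units.val_mul, coe_toPrincipalIdeal, mul_comm, FractionalIdeal.mem_singleton_mul]
  exact ⟨fun ⟨y, hy, h⟩ => ⟨y, hy, h.symm⟩, fun ⟨y, hy, h⟩ => ⟨y, hy, h.symm⟩⟩

theorem absNorm_mul_principal (I : (FractionalIdeal (𝓞 K)⁰ K)ˣ) (c : Kˣ) :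
    FractionalIdeal.absNorm ((I * toPrincipalIdeal (𝓞 K) K c : (FractionalIdeal (𝓞 K)⁰ K)ˣ) :
      FractionalIdeal (𝓞 K)⁰ K) =
    FractionalIdeal.absNorm (I : FractionalIdeal (𝓞 K)⁰ K) * |Algebra.norm ℚ (c : K)| := by
  rw [Units.val_mul, coe_toPrincipalIdeal, map_mul, FractionalIdeal.absNorm_span_singleton]

theorem pointMinimum_mul_principal (I : (FractionalIdeal (𝓞 K)⁰ K)ˣ) (c : Kˣ)
    (x : mixedEmbedding.mixedSpace K) :
    pointMinimum (I * toPrincipalIdeal (𝓞 K) K c) (mixedEmbedding K c * x) =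
      pointMinimum I x := by
  have hc : (c : K) ≠ 0 := c.ne_zero
  have hn : ((|Algebra.norm ℚ (c : K)| : ℚ) : ℝ) ≠ 0 := by
    simp [hc]
  symm
  unfold pointMinimum
  refine Function.Surjective.iInf_congr
    (fun γ => ⟨c * γ.1, mem_mul_principal.2 ⟨γ.1, γ.2, rfl⟩⟩) ?_ ?_
  · rintro ⟨y, hy⟩
    obtain ⟨z, hz, rfl⟩ := mem_mul_principal.1 hy
    exact ⟨⟨z, hz⟩, rfl⟩
  · rintro ⟨γ, hγ⟩
    simp only
    rw [absNorm_mul_principal, map_mul (mixedEmbedding K), ← mul_sub, map_mul,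
      mixedEmbedding.norm_eq_norm, Rat.cast_mul, mul_comm, mul_div_mul_right _ _ hn]

theorem idealMinimum_eq {I J : (FractionalIdeal (𝓞 K)⁰ K)ˣ}
    (h : ClassGroup.mk K I = ClassGroup.mk K J) : idealMinimum I = idealMinimum J := by
  obtain ⟨c, rfl⟩ := exists_mul_of_mk_eq h
  unfold idealMinimum
  refine Function.Surjective.iSup_congr (fun x => mixedEmbedding K c * x) ?_ ?_
  · intro y
    refine ⟨mixedEmbedding K (c : K)⁻¹ * y, ?_⟩
    simp only
    rw [← mul_assoc, ← map_mul, mul_inv_cancel₀ c.ne_zero, map_one, one_mul]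
  · intro x
    rw [pointMinimum_mul_principal]

theorem classMinimum_mk (I : (FractionalIdeal (𝓞 K)⁰ K)ˣ) :
    classMinimum (ClassGroup.mk K I) = idealMinimum I :=
  idealMinimum_eq (exists_class_rep (ClassGroup.mk K I)).choose_spec

theorem isNormEuclideanClass_mk (I : (FractionalIdeal (𝓞 K)⁰ K)ˣ) :
    IsNormEuclideanClass (ClassGroup.mk K I) ↔ IsNormEuclideanIdeal I := by
  refine ⟨?_, fun h => ⟨I, rfl, h⟩⟩
  rintro ⟨J, hJ, h⟩
  obtain ⟨c, rfl⟩ := exists_mul_of_mk_eq hJ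
  intro β
  obtain ⟨α, hα, hlt⟩ := h ((c : K)⁻¹ * β)
  refine ⟨c * α, mem_mul_principal.2 ⟨α, hα, rfl⟩, ?_⟩
  have hc : (c : K) ≠ 0 := c.ne_zero
  have e : c * α - β = c * (α - (c : K)⁻¹ * β) := by
    rw [mul_sub, mul_inv_cancel_left₀ hc]
  rw [absNorm_mul_principal, e, map_mul, abs_mul, mul_comm]
  refine mul_lt_mul_of_pos_right hlt (abs_pos.2 ?_)
  simp [hc]

end PadicCF

end

namespace PadicCF

variable {K : Type*} [Field K] [NumberField K]

/-! Finiteness follows from partial quotients that are small in norm: it suffices that `∏ (w(a) + 1)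
^ w.mult ≤ ν N(P)` with `ν < 1` for all values `a` of the floor function
(`FloorFunction.cff_of_prod_le`). Indeed, along an infinite expansion the error terms are nonzero,
their norms grow at least like `N(P)^n` by divisibility, and at most like `(ν N(P))^n` by their
recurrence.

To find such a floor function, write `P = eI` with `I` in the class. Reducing `z / e` modulo `I`
makes its norm at most `m N(I)` with `m < 1`, so `z` reduced modulo `P` has norm at most `m N(P)`.
The extra `+ 1` at each place is absorbed by a uniform slack `δ` (`exists_forall_prod_add_le`, by
compactness) once `w(e) ≥ 1/δ` for all `w`. A unit multiple of `e` achieves this when `N(P)` is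
large (`exists_unit_le_of_norm_ge`), and only finitely many `P` have bounded norm. -/

/-! ### Strong approximation and construction of floor functions -/

/-- Write `x = n / d` and `(d) = P ^ m * J` with `P ∤ J`. Take `y = e * x` with `e ∈ J` and `1 - e ∈
P ^ (m + 1)`: then `e` cancels the denominator away from `P`, and `1 - e` more than cancels it at
`P`. -/
theorem exists_integral_away_valuation_sub_lt_one (P : HeightOneSpectrum (𝓞 K)) (x : K) :
    ∃ y : K, P.valuation K (x - y) < 1 ∧
      ∀ v : HeightOneSpectrum (𝓞 K), v ≠ P → v.valuation K y ≤ 1 := by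
  obtain ⟨n, d, hd, rfl⟩ := IsFractionRing.div_surjective (A := 𝓞 K) x
  have hd0 : d ≠ 0 := nonZeroDivisors.ne_zero hd
  have hdK : algebraMap (𝓞 K) K d ≠ 0 := by simpa using hd0
  have hspan : Ideal.span {d} ≠ 0 := by simpa using hd0
  obtain ⟨m, J, hJ, hdJ⟩ := WfDvdMonoid.max_power_factor hspan P.irreducible
  have hcop : P.asIdeal ^ (m + 1) ⊔ J = ⊤ := by
    refine IsCoprime.sup_eq (IsCoprime.pow_left (Ideal.isCoprime_iff_sup_eq.2 ?_))
    by_contra hne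
    have := P.isMaximal.eq_of_le hne le_sup_left
    exact hJ (Ideal.dvd_iff_le.2 (this ▸ le_sup_right))
  obtain ⟨a, ha, e, he, hae⟩ :=
    Submodule.mem_sup.1 (hcop ▸ Submodule.mem_top : (1 : 𝓞 K) ∈ P.asIdeal ^ (m + 1) ⊔ J)
  refine ⟨algebraMap (𝓞 K) K e * (algebraMap (𝓞 K) K n / algebraMap (𝓞 K) K d), ?_, ?_⟩
  · have hdm : d ∉ P.asIdeal ^ (m + 1) := by
      intro h
      rw [← Ideal.dvd_span_singleton, hdJ, pow_succ] at h
      exact hJ ((mul_dvd_mul_iff_left (pow_ne_zero m P.ne_bot)).1 h)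
    have hlt : P.intValuation (a * n) < P.intValuation d := by
      rw [← P.intValuation_le_pow_iff_mem] at hdm
      exact lt_of_le_of_lt ((P.intValuation_le_pow_iff_mem _ _).2 (Ideal.mul_mem_right _ _ ha))
        (not_le.1 hdm)
    have e1 : algebraMap (𝓞 K) K n / algebraMap (𝓞 K) K d -
        algebraMap (𝓞 K) K e * (algebraMap (𝓞 K) K n / algebraMap (𝓞 K) K d) =
        algebraMap (𝓞 K) K (a * n) / algebraMap (𝓞 K) K d := by
      have : algebraMap (𝓞 K) K e = 1 - algebraMap (𝓞 K) K a := by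
        rw [← map_one (algebraMap (𝓞 K) K), ← map_sub, ← hae, add_sub_cancel_left]
      rw [this, map_mul]
      ring
    rw [e1, map_div₀, P.valuation_of_algebraMap, P.valuation_of_algebraMap]
    exact (div_lt_one₀ (zero_lt_iff.2 (P.intValuation_ne_zero d hd0))).2 hlt
  · intro v hv
    -- The factor `s` supplies the missing `P ^ m`, so that `d ∣ s * e`, and is a unit at `v`.
    obtain ⟨s, hsP, hsv⟩ : ∃ s ∈ P.asIdeal ^ m, s ∉ v.asIdeal := by
      by_contra! h
      have h1 : P.asIdeal ≤ v.asIdeal := v.isPrime.le_of_pow_le h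
      exact hv (HeightOneSpectrum.ext (P.isMaximal.eq_of_le v.isPrime.ne_top h1).symm)
    have hse : s * e ∈ Ideal.span {d} := hdJ ▸ Ideal.mul_mem_mul hsP he
    obtain ⟨t, ht⟩ := Ideal.mem_span_singleton'.1 hse
    have hsv1 : v.valuation K (algebraMap (𝓞 K) K s) = 1 := by simpa using hsv
    have e2 : v.valuation K (algebraMap (𝓞 K) K e) =
        v.valuation K (algebraMap (𝓞 K) K t) * v.valuation K (algebraMap (𝓞 K) K d) := by
      rw [← map_mul, ← map_mul, ht, map_mul, map_mul, hsv1, one_mul]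
    have hvd : v.valuation K (algebraMap (𝓞 K) K d) ≠ 0 := by simpa using hd0
    rw [map_mul, map_div₀, e2, mul_assoc, mul_div_cancel₀ _ hvd]
    exact mul_le_one' (v.valuation_le_one t) (v.valuation_le_one n)

theorem exists_integral_away_sub_lt_one (P : HeightOneSpectrum (𝓞 K)) (α : P.adicCompletion K) :
    ∃ y : K, Valued.v (α - algebraMap K (P.adicCompletion K) y) < 1 ∧
      ∀ v : HeightOneSpectrum (𝓞 K), v ≠ P → v.valuation K y ≤ 1 := by
  obtain ⟨x, hx⟩ : ∃ x : K, Valued.v (α - algebraMap K (P.adicCompletion K) x) < 1 := by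
    have hopen : IsOpen {β : P.adicCompletion K | Valued.v (α - β) < 1} := by
      have : IsOpen {β : P.adicCompletion K | Valued.v β < 1} := by
        simpa [Valuation.restrict_lt_one_iff] using Valued.isOpen_ball (P.adicCompletion K) 1
      exact this.preimage (continuous_const.sub continuous_id)
    obtain ⟨x, hx⟩ := (HeightOneSpectrum.denseRange_algebraMap (K := K) P).exists_mem_open
      hopen ⟨α, by simp⟩
    exact ⟨x, hx⟩
  obtain ⟨y, hy, hintegral⟩ := exists_integral_away_valuation_sub_lt_one P x
  refine ⟨y, ?_, hintegral⟩
  rw [← sub_add_sub_cancel α (algebraMap K _ x), ← map_sub]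
  exact Valuation.map_add_lt _ hx
    ((HeightOneSpectrum.valuedAdicCompletion_eq_valuation' P (x - y)).trans_lt hy)

/-- A floor function amounts to choosing a representative in each coset of the maximal ideal, with 0
representing the ideal itself; idempotence then follows from local constancy. -/
theorem exists_floorFunction (P : HeightOneSpectrum (𝓞 K)) (p : K → Prop) (h0 : p 0)
    (h : ∀ α : P.adicCompletion K, ∃ y : K, Valued.v (α - algebraMap K (P.adicCompletion K) y) < 1 ∧
      (∀ v : HeightOneSpectrum (𝓞 K), v ≠ P → v.valuation K y ≤ 1) ∧ p y) :
    ∃ s : FloorFunction K P, ∀ α, p (s.toFun α) := by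
  classical
  choose g hg hintegral hp using h
  let S : Setoid (P.adicCompletion K) :=
    { r := fun a b => Valued.v (a - b) < 1
      iseqv := ⟨fun a => by simp, fun {a b} hab => by rwa [Valuation.map_sub_swap],
        fun {a b c} hab hbc => by
          rw [← sub_add_sub_cancel a b c]; exact Valuation.map_add_lt _ hab hbc⟩ }
  let f : P.adicCompletion K → K := fun α =>
    if Valued.v α < 1 then 0 else g (Quotient.mk S α).out
  have hf : ∀ α, Valued.v (α - algebraMap K (P.adicCompletion K) (f α)) < 1 := by
    intro α
    by_cases hα : Valued.v α < 1
    · simp [f, hα]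
    · simp only [f, hα, if_false]
      have h1 : Valued.v ((Quotient.mk S α).out - α) < 1 := Quotient.mk_out (s := S) α
      rw [Valuation.map_sub_swap] at h1
      rw [← sub_add_sub_cancel α (Quotient.mk S α).out]
      exact Valuation.map_add_lt _ h1 (hg _)
  have hloc : ∀ α β, Valued.v (α - β) < 1 → f α = f β := by
    intro α β hαβ
    have hiff : Valued.v α < 1 ↔ Valued.v β < 1 := by
      refine ⟨fun ha => ?_, fun hb => ?_⟩
      · rw [← sub_sub_cancel α β]; exact Valuation.map_sub_lt _ ha hαβ
      · rw [← sub_add_cancel α β]; exact Valuation.map_add_lt _ hαβ hb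
    have hq : Quotient.mk S α = Quotient.mk S β := Quotient.sound (s := S) hαβ
    simp only [f, hiff, hq]
  refine ⟨⟨f, hf, ?_, by simp [f], ?_, hloc⟩, ?_⟩
  · intro α v hv
    by_cases hα : Valued.v α < 1
    · simp [f, hα]
    · simpa [f, hα] using hintegral _ v hv
  · intro α
    refine hloc _ _ ?_
    rw [Valuation.map_sub_swap]
    exact hf α
  · intro α
    by_cases hα : Valued.v α < 1
    · simpa only [f, hα, if_true] using h0
    · simpa only [f, hα, if_false] using hp _

/-! ### Finiteness of expansions with small partial quotients -/

/-- A nonzero element of `P ^ n` has norm at least `N(P) ^ n`. -/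
theorem absNorm_pow_le_abs_norm {P : HeightOneSpectrum (𝓞 K)} {x : K} (hx : x ≠ 0) (n : ℕ)
    (hP : P.valuation K x ≤ WithZero.exp (-(n : ℤ)))
    (hv : ∀ v : HeightOneSpectrum (𝓞 K), v ≠ P → v.valuation K x ≤ 1) :
    ((Ideal.absNorm P.asIdeal : ℝ)) ^ n ≤ ((|Algebra.norm ℚ x| : ℚ) : ℝ) := by
  obtain ⟨r, rfl⟩ : x ∈ (algebraMap (𝓞 K) K).range := by
    refine HeightOneSpectrum.mem_integers_of_valuation_le_one K x fun v => ?_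
    by_cases h : v = P
    · subst h
      refine hP.trans ?_
      rw [← WithZero.exp_zero, WithZero.exp_le_exp]
      omega
    · exact hv v h
  rw [P.valuation_of_algebraMap, P.intValuation_le_pow_iff_dvd] at hP
  have hr : r ≠ 0 := by rintro rfl; simp at hx
  have hdvd := map_dvd Ideal.absNorm hP
  have hle := Nat.le_of_dvd (Nat.pos_of_ne_zero (by simpa [Ideal.absNorm_eq_zero_iff] using hr)) hdvd
  rw [map_pow, Ideal.absNorm_span_singleton] at hle
  have e : |Algebra.norm ℚ (algebraMap (𝓞 K) K r)| = ((Algebra.norm ℤ r).natAbs : ℚ) := by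
    rw [← RingOfIntegers.coe_eq_algebraMap, ← Algebra.coe_norm_int, Nat.cast_natAbs, Int.cast_abs]
  rw [e]
  exact_mod_cast hle

/-- The error terms `∏_{j ≤ n} (α_j - a_j)` satisfy the recurrence of the convergents; they are
highly divisible by `P`, while their archimedean absolute values are controlled by the partial
quotients. -/
theorem FloorFunction.cff_of_prod_le {P : HeightOneSpectrum (𝓞 K)} (s : FloorFunction K P) {ν : ℝ}
    (hν : ν < 1)
    (hs : ∀ α, ∏ w : InfinitePlace K, (w (s.toFun α) + 1) ^ w.mult ≤
      ν * (Ideal.absNorm P.asIdeal : ℝ)) : s.CFF := by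
  intro α
  by_contra hfin
  simp only [HasFiniteExpansion, not_exists] at hfin
  let i := algebraMap K (P.adicCompletion K)
  let β : ℕ → K := fun n => Nat.rec α (fun _ b => (b - s.toFun (i b))⁻¹) n
  have hβs : ∀ n, β (n + 1) = (β n - s.toFun (i (β n)))⁻¹ := fun n => rfl
  have hβ : ∀ n, s.completeQuotient (i α) n = i (β n) := by
    intro n
    induction n with
    | zero => rfl
    | succ n ih => rw [completeQuotient, ih, hβs, map_inv₀, map_sub]
  let a : ℕ → K := fun n => s.toFun (i (β n))
  have hne : ∀ n, β n - a n ≠ 0 := by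
    intro n h
    apply hfin n
    change s.completeQuotient (i α) n = i (s.toFun (s.completeQuotient (i α) n))
    rw [hβ n]
    exact congrArg i (sub_eq_zero.1 h)
  -- The value group is discrete, so a valuation below 1 gains a full factor of `P`.
  have hval : ∀ n, P.valuation K (β n - a n) ≤ WithZero.exp (-1 : ℤ) := by
    intro n
    have h1 := s.sub_lt_one (i (β n))
    rw [← map_sub] at h1
    have h2 : P.valuation K (β n - a n) < 1 :=
      (HeightOneSpectrum.valuedAdicCompletion_eq_valuation' P (β n - a n)).symm.trans_lt h1
    have h3 := (Valuation.ne_zero_iff (P.valuation K)).2 (hne n)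
    rw [← WithZero.exp_zero, ← WithZero.log_lt_iff_lt_exp h3] at h2
    rw [← WithZero.log_le_iff_le_exp h3]
    omega
  obtain ⟨k, d, hd, hα⟩ := IsFractionRing.div_surjective (A := 𝓞 K) α
  have hd0 : d ≠ 0 := nonZeroDivisors.ne_zero hd
  have hdK : algebraMap (𝓞 K) K d ≠ 0 := by simpa using hd0
  -- The factor `d` clears the denominator of `α`, making `W 0` and `W 1` integral away from `P`;
  -- the recurrence propagates this, although the `β j` need not be integral there.
  let W : ℕ → K := fun n => algebraMap (𝓞 K) K d * ∏ j ∈ Finset.range n, (β j - a j)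
  have hW0 : W 0 = algebraMap (𝓞 K) K d := by simp [W]
  have hWs : ∀ n, W (n + 1) = W n * (β n - a n) := fun n => by
    simp only [W, Finset.prod_range_succ, mul_assoc]
  have hW1 : W 1 = algebraMap (𝓞 K) K k - a 0 * algebraMap (𝓞 K) K d := by
    rw [hWs, hW0, show β 0 = α from rfl, ← hα, mul_sub, mul_div_cancel₀ _ hdK, mul_comm (a 0)]
  have hWrec : ∀ n, W (n + 2) = W n - a (n + 1) * W (n + 1) := by
    intro n
    have h1 : W (n + 1) * β (n + 1) = W n := by
      rw [hWs, hβs, mul_assoc, mul_inv_cancel₀ (hne n), mul_one]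
    rw [hWs (n + 1), mul_sub, h1]
    exact congrArg _ (mul_comm _ _)
  have hWne : ∀ n, W n ≠ 0 := fun n =>
    mul_ne_zero hdK (Finset.prod_ne_zero_iff.2 fun j _ => hne j)
  have hWP : ∀ n, P.valuation K (W n) ≤ WithZero.exp (-(n : ℤ)) := by
    intro n
    induction n with
    | zero => simpa [hW0] using P.valuation_le_one d
    | succ n ih =>
      rw [hWs, map_mul]
      refine (mul_le_mul' ih (hval n)).trans_eq ?_
      rw [← WithZero.exp_add]
      congr 1
      push_cast
      ring
  have hintegral : ∀ v : HeightOneSpectrum (𝓞 K), v ≠ P → ∀ n, v.valuation K (a n) ≤ 1 :=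
    fun v hv n => s.integral_away _ v hv
  have hprod : ∀ n, ∏ w : InfinitePlace K, (w (a n) + 1) ^ w.mult ≤
      ν * (Ideal.absNorm P.asIdeal : ℝ) := fun n => hs _
  clear_value W a
  have hWv : ∀ v : HeightOneSpectrum (𝓞 K), v ≠ P → ∀ n, v.valuation K (W n) ≤ 1 := by
    intro v hv
    have ha := hintegral v hv
    refine Nat.twoStepInduction ?_ ?_ ?_
    · rw [hW0]; exact v.valuation_le_one d
    · rw [hW1]
      refine Valuation.map_sub_le _ (v.valuation_le_one k) ?_
      rw [map_mul]
      exact mul_le_one' (ha 0) (v.valuation_le_one d)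
    · intro n h1 h2
      rw [hWrec]
      refine Valuation.map_sub_le _ h1 ?_
      rw [map_mul]
      exact mul_le_one' (ha _) h2
  have hWw : ∀ w : InfinitePlace K, ∀ n, w (W n) ≤
      max (w (W 0)) (w (W 1)) * ∏ j ∈ Finset.range n, (w (a j) + 1) := by
    intro w
    have h1 : ∀ n, 1 ≤ w (a n) + 1 := fun n => by simp [apply_nonneg]
    have h0 : 0 ≤ max (w (W 0)) (w (W 1)) := le_max_of_le_left (apply_nonneg _ _)
    have hpos : ∀ n, 0 ≤ ∏ j ∈ Finset.range n, (w (a j) + 1) := fun n =>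
      Finset.prod_nonneg fun j _ => zero_le_one.trans (h1 j)
    refine Nat.twoStepInduction ?_ ?_ ?_
    · simp
    · simp only [Finset.prod_range_one]
      exact (le_max_right _ _).trans (le_mul_of_one_le_right h0 (h1 0))
    · intro n hn hn1
      have hsub : ∀ x y : K, w (x - y) ≤ w x + w y := fun x y => by
        simpa only [← InfinitePlace.norm_embedding_eq, map_sub] using norm_sub_le _ _
      rw [hWrec]
      refine (hsub _ _).trans ?_
      rw [map_mul, Finset.prod_range_succ]
      have hmono : ∏ j ∈ Finset.range n, (w (a j) + 1) ≤
          ∏ j ∈ Finset.range (n + 1), (w (a j) + 1) := by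
        rw [Finset.prod_range_succ]
        exact le_mul_of_one_le_right (hpos n) (h1 n)
      have h2 := hn.trans (mul_le_mul_of_nonneg_left hmono h0)
      have h3 := mul_le_mul_of_nonneg_left hn1 (apply_nonneg w (a (n + 1)))
      linarith
  let A : ℝ := ∏ w : InfinitePlace K, max (w (W 0)) (w (W 1)) ^ w.mult
  let q : ℝ := Ideal.absNorm P.asIdeal
  have hq : 0 < q := by
    have : Ideal.absNorm P.asIdeal ≠ 0 := by
      simpa [Ideal.absNorm_eq_zero_iff] using P.ne_bot
    exact Nat.cast_pos.2 (Nat.pos_of_ne_zero this)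
  have hA : 0 ≤ A := Finset.prod_nonneg fun w _ =>
    pow_nonneg (le_max_of_le_left (apply_nonneg _ _)) _
  have hbound : ∀ n, q ^ n ≤ A * (ν * q) ^ n := by
    intro n
    refine (absNorm_pow_le_abs_norm (hWne n) n (hWP n) (fun v hv => hWv v hv n)).trans ?_
    rw [← InfinitePlace.prod_eq_abs_norm]
    calc ∏ w : InfinitePlace K, w (W n) ^ w.mult
        ≤ ∏ w : InfinitePlace K, (max (w (W 0)) (w (W 1)) *
            ∏ j ∈ Finset.range n, (w (a j) + 1)) ^ w.mult :=
          Finset.prod_le_prod (fun w _ => pow_nonneg (apply_nonneg _ _) _) fun w _ =>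
            pow_le_pow_left₀ (apply_nonneg _ _) (hWw w n) _
      _ = A * ∏ j ∈ Finset.range n, ∏ w : InfinitePlace K, (w (a j) + 1) ^ w.mult := by
          simp_rw [mul_pow, Finset.prod_mul_distrib, ← Finset.prod_pow]
          rw [Finset.prod_comm]
      _ ≤ A * ∏ j ∈ Finset.range n, (ν * q) := by
          refine mul_le_mul_of_nonneg_left (Finset.prod_le_prod (fun j _ => ?_) fun j _ => hprod j) hA
          exact Finset.prod_nonneg fun w _ => pow_nonneg (by have := apply_nonneg w (a j); linarith) _
      _ = A * (ν * q) ^ n := by simp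
  -- As `s(0) = 0`, the hypothesis at `α = 0` reads `1 ≤ ν * q`.
  have hν0 : 0 ≤ ν := by
    have h1 := hs 0
    rw [s.map_zero] at h1
    have h2 : (1 : ℝ) ≤ ν * q := by simpa using h1
    by_contra! hneg
    nlinarith
  have hone : ∀ n, 1 ≤ A * ν ^ n := by
    intro n
    have := hbound n
    rw [mul_pow, ← mul_assoc] at this
    exact (le_mul_iff_one_le_left (pow_pos hq n)).1 this
  have hlim : Filter.Tendsto (fun n => A * ν ^ n) Filter.atTop (nhds (A * 0)) :=
    (tendsto_pow_atTop_nhds_zero_of_lt_one hν0 hν).const_mul A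
  rw [mul_zero] at hlim
  exact absurd (ge_of_tendsto' hlim hone) (by norm_num)

/-! ### Balancing absolute values by units -/

/-- A unit moves `c` into the fundamental cone, and division by `|N(c)|^(1/n)`, where `n = [K : ℚ]`,
brings it to norm 1; the part of the cone of norm at most 1 is bounded. -/
theorem exists_unit_le_mul_rpow (K : Type*) [Field K] [NumberField K] :
    ∃ B : ℝ, 0 < B ∧ ∀ c : K, c ≠ 0 → ∃ u : (𝓞 K)ˣ, ∀ w : InfinitePlace K,
      w (algebraMap (𝓞 K) K u * c) ≤
        B * ((|Algebra.norm ℚ c| : ℚ) : ℝ) ^ (Module.finrank ℚ K : ℝ)⁻¹ := by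
  classical
  obtain ⟨B, hB⟩ := isBounded_iff_forall_norm_le.1
    (mixedEmbedding.fundamentalCone.isBounded_normLeOne K)
  refine ⟨max B 1, lt_max_of_lt_right one_pos, fun c hc => ?_⟩
  have hNpos : 0 < ((|Algebra.norm ℚ c| : ℚ) : ℝ) := by
    have : 0 < |Algebra.norm ℚ c| := abs_pos.2 (by simpa using hc)
    exact_mod_cast this
  have hne : mixedEmbedding.norm (mixedEmbedding K c) ≠ 0 := by
    rw [mixedEmbedding.norm_eq_norm]; exact hNpos.ne'
  obtain ⟨u, hu⟩ := mixedEmbedding.fundamentalCone.exists_unit_smul_mem hne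
  set r : ℝ := ((|Algebra.norm ℚ c| : ℚ) : ℝ) ^ (Module.finrank ℚ K : ℝ)⁻¹ with hr
  have hrpos : 0 < r := Real.rpow_pos_of_pos hNpos _
  have hrn : r ^ Module.finrank ℚ K = ((|Algebra.norm ℚ c| : ℚ) : ℝ) :=
    Real.rpow_inv_natCast_pow hNpos.le Module.finrank_pos.ne'
  have hmem : r⁻¹ • u • mixedEmbedding K c ∈ mixedEmbedding.fundamentalCone.normLeOne K := by
    refine ⟨mixedEmbedding.fundamentalCone.smul_mem_of_mem hu (inv_ne_zero hrpos.ne'), ?_⟩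
    change mixedEmbedding.norm _ ≤ 1
    rw [mixedEmbedding.norm_smul, mixedEmbedding.norm_unit_smul, mixedEmbedding.norm_eq_norm,
      abs_of_pos (inv_pos.2 hrpos), inv_pow, hrn, inv_mul_cancel₀ hNpos.ne']
  refine ⟨u, fun w => ?_⟩
  have h1 : mixedEmbedding.normAtPlace w (r⁻¹ • u • mixedEmbedding K c) ≤ max B 1 := by
    refine le_trans ?_ ((hB _ hmem).trans (le_max_left _ _))
    rw [mixedEmbedding.norm_eq_sup'_normAtPlace]
    exact Finset.le_sup' (fun w => mixedEmbedding.normAtPlace w _) (Finset.mem_univ w)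
  rw [mixedEmbedding.normAtPlace_smul, mixedEmbedding.unitSMul_smul, ← map_mul,
    mixedEmbedding.normAtPlace_apply, abs_of_pos (inv_pos.2 hrpos), inv_mul_le_iff₀ hrpos] at h1
  rwa [mul_comm (max B 1)]

/-- The elements of large norm can be made large at all infinite places simultaneously by
multiplying them by a unit. -/
theorem exists_unit_le_of_norm_ge (K : Type*) [Field K] [NumberField K] (R : ℝ) :
    ∃ Q : ℝ, ∀ c : K, Q ≤ ((|Algebra.norm ℚ c| : ℚ) : ℝ) → c ≠ 0 → ∃ u : (𝓞 K)ˣ,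
      ∀ w : InfinitePlace K, R ≤ w (algebraMap (𝓞 K) K u * c) := by
  obtain ⟨B, hB, h⟩ := exists_unit_le_mul_rpow K
  have hn : 0 < (Module.finrank ℚ K : ℝ)⁻¹ := by
    have := Module.finrank_pos (R := ℚ) (M := K)
    positivity
  have htend := (tendsto_rpow_atTop hn).eventually_ge_atTop (B * R)
  obtain ⟨Q, hQ⟩ := Filter.eventually_atTop.1 htend
  refine ⟨Q, fun c hc hc0 => ?_⟩
  -- Upper bounds for `u * c⁻¹` are lower bounds for `u⁻¹ * c`.
  obtain ⟨u, hu⟩ := h c⁻¹ (inv_ne_zero hc0)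
  refine ⟨u⁻¹, fun w => ?_⟩
  have hupos : 0 < w (algebraMap (𝓞 K) K u * c⁻¹) := by
    rw [InfinitePlace.pos_iff]
    exact mul_ne_zero (by simp) (inv_ne_zero hc0)
  have e : w (algebraMap (𝓞 K) K (u⁻¹ : (𝓞 K)ˣ) * c) = (w (algebraMap (𝓞 K) K u * c⁻¹))⁻¹ := by
    rw [← map_inv₀, mul_inv, inv_inv]
    congr 2
    refine eq_inv_of_mul_eq_one_left ?_
    rw [← map_mul, Units.inv_mul, map_one]
  have h1 := hu w
  have h2 := hQ _ hc
  have hN0 : 0 < ((|Algebra.norm ℚ c| : ℚ) : ℝ) := by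
    have : 0 < |Algebra.norm ℚ c| := abs_pos.2 (by simpa using hc0)
    exact_mod_cast this
  have hNinv : Algebra.norm ℚ c⁻¹ = (Algebra.norm ℚ c)⁻¹ := by
    refine eq_inv_of_mul_eq_one_left ?_
    rw [← map_mul, inv_mul_cancel₀ hc0, map_one]
  rw [hNinv, abs_inv, Rat.cast_inv, Real.inv_rpow hN0.le] at h1
  have hrpos := Real.rpow_pos_of_pos hN0 (Module.finrank ℚ K : ℝ)⁻¹
  have h3 := mul_le_mul_of_nonneg_right h2 hupos.le
  have h4 := (le_mul_inv_iff₀ hrpos).1 h1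
  rw [e, ← one_div, le_div_iff₀ hupos]
  refine le_of_mul_le_mul_left ?_ hB
  linarith

/-! ### Uniform slack in the Euclidean minimum -/

theorem absNorm_units_pos (I : (FractionalIdeal (𝓞 K)⁰ K)ˣ) :
    0 < (FractionalIdeal.absNorm (I : FractionalIdeal (𝓞 K)⁰ K) : ℝ) := by
  have h0 : FractionalIdeal.absNorm (I : FractionalIdeal (𝓞 K)⁰ K) ≠ 0 := by
    simp
  have h1 := FractionalIdeal.absNorm_nonneg (I : FractionalIdeal (𝓞 K)⁰ K)
  exact_mod_cast lt_of_le_of_ne h1 h0.symm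

/-- For each point some `γ` gives a strict inequality at `δ = 0`, which persists for some `δ > 0` on
a neighbourhood. Finitely many such neighbourhoods cover the closure of a fundamental domain of `I`,
and translation by `I` reaches every point. -/
theorem exists_forall_prod_add_le (I : (FractionalIdeal (𝓞 K)⁰ K)ˣ) (hI : idealMinimum I < 1) :
    ∃ m < 1, ∃ δ > 0, ∀ x : mixedEmbedding.mixedSpace K,
      ∃ γ ∈ (I : FractionalIdeal (𝓞 K)⁰ K),
        ∏ w : InfinitePlace K,
          (mixedEmbedding.normAtPlace w (x - mixedEmbedding K γ) + δ) ^ w.mult ≤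
        m * (FractionalIdeal.absNorm (I : FractionalIdeal (𝓞 K)⁰ K) : ℝ) := by
  classical
  obtain ⟨m, hm0, hIm, hm1⟩ := ENNReal.lt_iff_exists_real_btwn.1 hI
  rw [ENNReal.ofReal_lt_one] at hm1
  refine ⟨m, hm1, ?_⟩
  set N : ℝ := (FractionalIdeal.absNorm (I : FractionalIdeal (𝓞 K)⁰ K) : ℝ) with hN
  have hNpos : 0 < N := absNorm_units_pos I
  let f : K → ℝ → mixedEmbedding.mixedSpace K → ℝ := fun γ δ x =>
    ∏ w : InfinitePlace K, (mixedEmbedding.normAtPlace w (x - mixedEmbedding K γ) + δ) ^ w.mult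
  have hfx : ∀ γ δ, Continuous (f γ δ) := fun γ δ =>
    continuous_finsetProd _ fun w _ => (((mixedEmbedding.continuous_normAtPlace w).comp
      (continuous_id.sub continuous_const)).add continuous_const).pow _
  have hfδ : ∀ γ x, Continuous fun δ => f γ δ x := fun γ x =>
    continuous_finsetProd _ fun w _ => (continuous_const.add continuous_id).pow _
  have hfmono : ∀ γ x δ δ', 0 ≤ δ → δ ≤ δ' → f γ δ x ≤ f γ δ' x := fun γ x δ δ' h0 h =>
    Finset.prod_le_prod
      (fun w _ => pow_nonneg (add_nonneg (mixedEmbedding.normAtPlace_nonneg _ _) h0) _)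
      fun w _ => pow_le_pow_left₀ (add_nonneg (mixedEmbedding.normAtPlace_nonneg _ _) h0)
        (by linarith) _
  let U : {γ : K // γ ∈ (I : FractionalIdeal (𝓞 K)⁰ K)} × ℕ → Set (mixedEmbedding.mixedSpace K) :=
    fun i => {x | f i.1 (1 / (i.2 + 1)) x < m * N}
  have hU : ∀ i, IsOpen (U i) := fun i => isOpen_Iio.preimage (hfx _ _)
  have hcover : ∀ x, ∃ i, x ∈ U i := by
    intro x
    have h1 : pointMinimum I x < m := by
      have h2 : ENNReal.ofReal (pointMinimum I x) < ENNReal.ofReal m :=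
        (le_iSup (fun x => ENNReal.ofReal (pointMinimum I x)) x).trans_lt hIm
      exact (ENNReal.ofReal_lt_ofReal_iff_of_nonneg
        (Real.iInf_nonneg fun γ => div_nonneg (mixedEmbedding.norm_nonneg _) hNpos.le)).1 h2
    have : Nonempty {γ : K // γ ∈ (I : FractionalIdeal (𝓞 K)⁰ K)} :=
      ⟨⟨0, FractionalIdeal.zero_mem _⟩⟩
    obtain ⟨γ, hγ⟩ := exists_lt_of_ciInf_lt h1
    rw [div_lt_iff₀ hNpos] at hγ
    have h0 : f γ 0 x < m * N := by simpa [f, mixedEmbedding.norm_apply] using hγ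
    have htend := ((hfδ γ x).tendsto 0).comp (tendsto_one_div_add_atTop_nhds_zero_nat (𝕜 := ℝ))
    obtain ⟨k, hk⟩ := (htend.eventually_lt_const h0).exists
    exact ⟨(γ, k), hk⟩
  let b := mixedEmbedding.fractionalIdealLatticeBasis K I
  have hcpt : IsCompact (closure (ZSpan.fundamentalDomain b)) :=
    (ZSpan.fundamentalDomain_isBounded b).isCompact_closure
  obtain ⟨t, ht⟩ := hcpt.elim_finite_subcover U hU fun x _ => Set.mem_iUnion.2 (hcover x)
  -- The smallest slack in the finite subcover serves everywhere, by monotonicity in `δ`.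
  refine ⟨1 / ((t.sup Prod.snd : ℕ) + 1), by positivity, fun x => ?_⟩
  have hx := ht (subset_closure (ZSpan.fract_mem_fundamentalDomain b x))
  simp only [Set.mem_iUnion] at hx
  obtain ⟨⟨γ, k⟩, hit, hx⟩ := hx
  obtain ⟨γ₀, hγ₀, hfl⟩ :=
    (mixedEmbedding.mem_span_fractionalIdealLatticeBasis K I).1 (ZSpan.floor b x).2
  refine ⟨γ₀ + γ, Submodule.add_mem (I : FractionalIdeal (𝓞 K)⁰ K).coeToSubmodule hγ₀ γ.2, ?_⟩
  change f (γ₀ + γ) _ x ≤ _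
  have e : ∀ δ, f (γ₀ + γ) δ x = f γ δ (ZSpan.fract b x) := by
    intro δ
    simp only [f, ZSpan.fract_apply, ← hfl, map_add, sub_sub]
  rw [e]
  refine (hfmono _ _ _ _ (by positivity) ?_).trans (le_of_lt hx)
  have hk : k ≤ t.sup Prod.snd := Finset.le_sup (f := Prod.snd) hit
  exact Nat.one_div_le_one_div hk

/-! ### Primes of large norm in the class -/

theorem valuation_of_mem_coeIdeal {P : HeightOneSpectrum (𝓞 K)} {x : K}
    (hx : x ∈ (P.asIdeal : FractionalIdeal (𝓞 K)⁰ K)) :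
    P.valuation K x < 1 ∧ ∀ v : HeightOneSpectrum (𝓞 K), v.valuation K x ≤ 1 := by
  obtain ⟨r, hr, rfl⟩ := (FractionalIdeal.mem_coeIdeal _).1 hx
  exact ⟨(P.valuation_lt_one_iff_mem r).2 hr, fun v => v.valuation_le_one r⟩

theorem exists_hasCFF_of_absNorm_ge (C : ClassGroup (𝓞 K)) (hM : classMinimum C < 1) :
    ∃ Q : ℝ, ∀ P : HeightOneSpectrum (𝓞 K), primeClass P = C →
      Q ≤ (Ideal.absNorm P.asIdeal : ℝ) → HasCFF K P := by
  obtain ⟨I, rfl⟩ := exists_class_rep C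
  rw [classMinimum_mk] at hM
  obtain ⟨m, hm, δ, hδ, happ⟩ := exists_forall_prod_add_le I hM
  obtain ⟨Q, hQ⟩ := exists_unit_le_of_norm_ge K δ⁻¹
  have hNpos : 0 < (FractionalIdeal.absNorm (I : FractionalIdeal (𝓞 K)⁰ K) : ℝ) := absNorm_units_pos I
  set N : ℝ := (FractionalIdeal.absNorm (I : FractionalIdeal (𝓞 K)⁰ K) : ℝ) with hN
  -- The bound 1/2 serves only to make `ν` positive.
  obtain ⟨ν, hmν, hν⟩ := exists_between (max_lt hm one_half_lt_one)
  have hν0 : 0 < ν := lt_of_le_of_lt (by norm_num) ((le_max_right _ _).trans_lt hmν)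
  -- With `P = cI`, the first term gives `|N(c)| ≥ Q`; the second makes the partial quotient 0
  -- admissible.
  refine ⟨max (Q * N) ν⁻¹, fun P hP hPQ => ?_⟩
  let J : (FractionalIdeal (𝓞 K)⁰ K)ˣ :=
    FractionalIdeal.mk0 K ⟨P.asIdeal, mem_nonZeroDivisors_of_ne_zero P.ne_bot⟩
  have hJ : ClassGroup.mk K I = ClassGroup.mk K J := by
    rw [← hP, primeClass, ClassGroup.mk_mk0]
  obtain ⟨c, hc⟩ := exists_mul_of_mk_eq hJ
  have hnorm : (Ideal.absNorm P.asIdeal : ℝ) = N * ((|Algebra.norm ℚ (c : K)| : ℚ) : ℝ) := by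
    have h1 := absNorm_mul_principal I c
    rw [hc, FractionalIdeal.coe_mk0, FractionalIdeal.coeIdeal_absNorm] at h1
    rw [hN, ← Rat.cast_mul, ← h1, Rat.cast_natCast]
  obtain ⟨u, hu⟩ := hQ c (by
    have := (le_max_left _ _).trans hPQ
    rw [hnorm, mul_comm] at this
    exact le_of_mul_le_mul_left this hNpos) c.ne_zero
  set e : K := algebraMap (𝓞 K) K u * c with he
  have he0 : e ≠ 0 := mul_ne_zero (by simp) c.ne_zero
  have heN : ∏ w : InfinitePlace K, w e ^ w.mult = ((|Algebra.norm ℚ (c : K)| : ℚ) : ℝ) := by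
    rw [InfinitePlace.prod_eq_abs_norm, he, map_mul, abs_mul, ← RingOfIntegers.coe_eq_algebraMap,
      Units.norm, one_mul]
  have hrep : ∀ z : K, ∃ γ ∈ (P.asIdeal : FractionalIdeal (𝓞 K)⁰ K),
      ∏ w : InfinitePlace K, (w (z - γ) + 1) ^ w.mult ≤ ν * (Ideal.absNorm P.asIdeal : ℝ) := by
    intro z
    -- Multiplying back by `e` turns the slack `δ` into `w e * δ ≥ 1`, and `e * γ ∈ P` because `e`
    -- differs from `c` by a unit.
    obtain ⟨γ, hγ, hprod⟩ := happ (mixedEmbedding K (z / e))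
    refine ⟨e * γ, ?_, ?_⟩
    · have h1 : e * γ ∈ (J : FractionalIdeal (𝓞 K)⁰ K) := by
        rw [← hc, mem_mul_principal]
        refine ⟨algebraMap (𝓞 K) K u * γ, ?_, by rw [he]; ring⟩
        rw [← Algebra.smul_def]
        exact Submodule.smul_mem (I : FractionalIdeal (𝓞 K)⁰ K).coeToSubmodule _ hγ
      exact h1
    · calc ∏ w : InfinitePlace K, (w (z - e * γ) + 1) ^ w.mult
          ≤ ∏ w : InfinitePlace K, (w e * (mixedEmbedding.normAtPlace w
              (mixedEmbedding K (z / e) - mixedEmbedding K γ) + δ)) ^ w.mult := by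
            refine Finset.prod_le_prod
              (fun w _ => pow_nonneg (add_nonneg (apply_nonneg _ _) zero_le_one) _)
              fun w _ => pow_le_pow_left₀ (add_nonneg (apply_nonneg _ _) zero_le_one) ?_ _
            rw [← map_sub, mixedEmbedding.normAtPlace_apply, mul_add, ← map_mul, mul_sub,
              mul_div_cancel₀ _ he0]
            have h1 := mul_le_mul_of_nonneg_right (hu w) hδ.le
            rw [inv_mul_cancel₀ hδ.ne'] at h1
            linarith
        _ ≤ ((|Algebra.norm ℚ (c : K)| : ℚ) : ℝ) * (m * N) := by
            simp_rw [mul_pow, Finset.prod_mul_distrib]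
            rw [heN]
            exact mul_le_mul_of_nonneg_left hprod (by exact_mod_cast abs_nonneg _)
        _ = m * (Ideal.absNorm P.asIdeal : ℝ) := by rw [hnorm]; ring
        _ ≤ ν * (Ideal.absNorm P.asIdeal : ℝ) :=
            mul_le_mul_of_nonneg_right ((le_max_left _ _).trans hmν.le) (Nat.cast_nonneg _)
  obtain ⟨s, hs⟩ := exists_floorFunction P
    (fun y => ∏ w : InfinitePlace K, (w y + 1) ^ w.mult ≤ ν * (Ideal.absNorm P.asIdeal : ℝ))
    (by
      have h1 := (le_max_right _ _).trans hPQ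
      rw [inv_le_iff_one_le_mul₀' hν0] at h1
      simpa using h1)
    (fun α => by
      obtain ⟨z, hz, hzv⟩ := exists_integral_away_sub_lt_one P α
      obtain ⟨γ, hγ, hprod⟩ := hrep z
      obtain ⟨hγP, hγv⟩ := valuation_of_mem_coeIdeal hγ
      refine ⟨z - γ, ?_, fun v hv => Valuation.map_sub_le _ (hzv v hv) (hγv v), hprod⟩
      rw [(algebraMap K (P.adicCompletion K)).map_sub, ← sub_add]
      exact Valuation.map_add_lt _ hz
        ((HeightOneSpectrum.valuedAdicCompletion_eq_valuation' P γ).trans_lt hγP))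
  exact ⟨s, s.cff_of_prod_le hν hs⟩

end PadicCF

theorem theorem7p4 (K : Type*) [Field K] [NumberField K] (C : ClassGroup (𝓞 K))
    (hC : PadicCF.IsNormEuclideanClass C) (hM : PadicCF.classMinimum C < 1) :
    {P : HeightOneSpectrum (𝓞 K) | PadicCF.primeClass P = C ∧ ¬ PadicCF.HasCFF K P}.Finite := by
  obtain ⟨Q, hQ⟩ := PadicCF.exists_hasCFF_of_absNorm_ge C hM
  refine Set.Finite.of_finite_image (f := HeightOneSpectrum.asIdeal) ?_
    fun P _ P' _ h => HeightOneSpectrum.ext h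
  refine (Ideal.finite_setOfPred_absNorm_le (S := 𝓞 K) ⌈Q⌉₊).subset ?_
  rintro _ ⟨P, ⟨hP, hcff⟩, rfl⟩
  by_contra hlt
  exact hcff (hQ P hP ((Nat.le_ceil Q).trans (by exact_mod_cast (not_le.1 hlt).le)))
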